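/- All graphs are finite and simple, and "clique" means inclusion-maximal clique. A block of a graph is a maximal connected subgraph that remains connected upon the removal of any single vertex, and a block graph is a graph all of whose blocks are complete. For $n\ge 1$, an $n$-clique path $P=\mathrm{CP}(B_1,\dots,B_n)$ in a graph $H$ is a sequence of $n$ distinct cliques of $H$ such that consecutive cliques $B_i$ and $B_{i+1}$ share exactly one vertex $x_i$ and non-consecutive cliques are disjoint; the vertices $x_1,\dots,x_{n-1}$ are its connecting vertices, $n$ is its length, and $V(P)=B_1\cup\dots\cup B_n$. A connected graph $H$ is called a $\mathcal T_1$-graph if it is a block graph and contains a clique path $P=\mathrm{CP}(B_1,\dots,B_n)$ of maximum length such that for every clique $K$ of $H$ other than $B_1,\dots,B_n$ there is an $i$ with $1\le i\le n-1$ and $K\cap V(P)=\{x_i\}$. An arbitrary graph $G$ is called a $\mathcal T_1$-graph if each of its connected components is a $\mathcal T_1$-graph. For $r\ge 1$, $\mathrm{Ind}_r(G)$ is the simplicial complex of all $A\subseteq V(G)$ such that every connected component of the induced subgraph $G[A]$ has at most $r$ vertices. A (not necessarily pure) simplicial complex is shellable if its facets can be ordered $F_1,\dots,F_t$ such that for each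 $k>1$ the complex $\langle F_k\rangle\cap\langle F_1,\dots,F_{k-1}\rangle$ is pure of dimension $\dim F_k-1$, where $\langle\mathcal F\rangle$ denotes the simplicial complex generated by $\mathcal F$. **Theorem.** If $G$ is a $\mathcal T_1$-graph, then $\mathrm{Ind}_r(G)$ is shellable for all $r\ge 5$. -/

import Mathlib

/-- A vertex set inducing a connected subgraph that remains connected (or becomes empty) upon the
removal of any single vertex. -/
def SimpleGraph.IsNonseparable {V : Type*} (G : SimpleGraph V) (s : Set V) : Prop :=
  (G.induce s).Connected ∧ ∀ v ∈ s, (G.induce (s \ {v})).Preconnected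

/-- A block: a maximal nonseparable subgraph. Such a subgraph is always induced, so it is recorded
by its vertex set. -/
def SimpleGraph.IsBlock {V : Type*} (G : SimpleGraph V) (s : Set V) : Prop :=
  Maximal G.IsNonseparable s

/-- A block graph: every block is a complete graph. -/
def SimpleGraph.IsBlockGraph {V : Type*} (G : SimpleGraph V) : Prop :=
  ∀ s : Set V, G.IsBlock s → G.IsClique s

/-- `G.IsCliquePath B` says that the cliques `B 0, …, B (n - 1)` of `G` form an `n`-clique path in
`G`, `n ≥ 1`: consecutive cliques share exactly one vertex and non-consecutive ones share none.
As usual for cliques of a block graph, the cliques are maximal, by inclusion. -/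
structure SimpleGraph.IsCliquePath {V : Type*} (G : SimpleGraph V) {n : ℕ} (B : Fin n → Set V) :
    Prop where
  pos : 1 ≤ n
  maximal : ∀ i, Maximal G.IsClique (B i)
  injective : Function.Injective B
  consecutive : ∀ i j : Fin n, (j : ℕ) = (i : ℕ) + 1 → ∃ x, B i ∩ B j = {x}
  nonconsecutive : ∀ i j : Fin n, (i : ℕ) + 1 < (j : ℕ) → Disjoint (B i) (B j)

/-- `x` is one of the connecting vertices of the clique path `B`, that is, the common vertex of
two consecutive cliques. -/
def IsConnectingVertex {V : Type*} {n : ℕ} (B : Fin n → Set V) (x : V) : Prop :=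
  ∃ i j : Fin n, (j : ℕ) = (i : ℕ) + 1 ∧ B i ∩ B j = {x}

/-- A connected `𝒯₁`-graph: a connected block graph with a clique path of maximum length such that
every (maximal) clique not belonging to the path meets the path in exactly one vertex, which is a
connecting vertex. -/
def SimpleGraph.IsConnectedT1Graph {V : Type*} (H : SimpleGraph V) : Prop :=
  H.Connected ∧ H.IsBlockGraph ∧
    ∃ (n : ℕ) (B : Fin n → Set V), H.IsCliquePath B ∧
      (∀ (m : ℕ) (B' : Fin m → Set V), H.IsCliquePath B' → m ≤ n) ∧
      ∀ K : Set V, Maximal H.IsClique K → K ∉ Set.range B →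
        ∃ x, IsConnectingVertex B x ∧ K ∩ (⋃ i, B i) = {x}

/-- A `𝒯₁`-graph: every connected component is a connected `𝒯₁`-graph. -/
def SimpleGraph.IsT1Graph {V : Type*} (G : SimpleGraph V) : Prop :=
  ∀ C : G.ConnectedComponent, C.toSimpleGraph.IsConnectedT1Graph

/-- `A` is `r`-independent in `G`: every connected component of `G[A]` has at most `r` vertices. -/
def SimpleGraph.IsRIndep {V : Type*} (G : SimpleGraph V) (r : ℕ) (A : Finset V) : Prop :=
  ∀ C : (G.induce (A : Set V)).ConnectedComponent, C.supp.ncard ≤ r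

theorem SimpleGraph.IsRIndep.mono {V : Type*} {G : SimpleGraph V} {r : ℕ} {A A' : Finset V}
    (h : A' ⊆ A) (hA : G.IsRIndep r A) : G.IsRIndep r A' := by
  intro C
  let φ := SimpleGraph.induceHomOfLE G (s := (A' : Set V)) (s' := (A : Set V)) (by exact_mod_cast h)
  refine le_trans ?_ (hA (C.map φ.toHom))
  refine Set.ncard_le_ncard_of_injOn φ ?_ φ.injective.injOn (Set.toFinite _)
  intro v hv
  rw [SimpleGraph.ConnectedComponent.mem_supp_iff] at hv
  subst hv
  exact (SimpleGraph.ConnectedComponent.mem_supp_iff _ _).2 rfl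

/-- The `r`-independence complex of `G`. Simplicial complexes are here families of finite sets
closed under taking subsets; the empty set is a face (of dimension `-1`). -/
def SimpleGraph.Ind {V : Type*} (r : ℕ) (G : SimpleGraph V) : LowerSet (Finset V) where
  carrier := {A | G.IsRIndep r A}
  lower' := fun _ _ h hA => hA.mono h

/-- The facets of a simplicial complex: its inclusion-maximal faces. -/
def IsFacet {V : Type*} (Δ : LowerSet (Finset V)) (F : Finset V) : Prop :=
  Maximal (· ∈ Δ) F

/-- (Non-pure) shellability of a finite simplicial complex: the facets can be ordered
`F 0, …, F (t - 1)` such that for every `k > 0` the complex `⟨F k⟩ ∩ ⟨F 0, …, F (k - 1)⟩` is pure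
of dimension `dim (F k) - 1`, i.e. each of its facets has one vertex less than `F k`. -/
def IsShellable {V : Type*} (Δ : LowerSet (Finset V)) : Prop :=
  ∃ (t : ℕ) (F : Fin t → Finset V), Function.Injective F ∧ Set.range F = {S | IsFacet Δ S} ∧
    ∀ k : Fin t, 0 < (k : ℕ) → ∀ S : Finset V,
      IsFacet (LowerSet.Iic (F k) ⊓ lowerClosure (F '' Set.Iio k)) S → S.card + 1 = (F k).card

/-! Shellability follows by induction from a combinatorial notion of simplicial vertex, in all
minors of the complex at once. Fix a minor (contract `C`, restrict to `U`) and a simplicial vertex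
`v`. Each facet avoiding `v` then has a smallest subset whose extension by `v` is a nonface. Shell
the facets through `v` first and then the others, grouped by this subset; both parts are governed by
smaller minors.

For `Ind r G`, a vertex whose neighborhood is a clique is simplicial in every minor. If no such
vertex is left in `U \ C`, then in a `𝒯₁`-graph the vertices of `U \ C` in any one component are
connecting vertices of its clique path, and a connecting vertex separates the earlier ones from the
later ones. The first one left is simplicial in the minor: if connected sets leading from `v` each
contained a vertex of `U \ C` missing from the other's side, one of these vertices would block the
way to the other. -/

section Shelling

/-! ### Shelling orders from simplicial vertices. -/

/-- The faces of `Δ` that are maximal among those lying between `C` and `U`. They correspond to the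
facets of the minor of `Δ` obtained by contracting `C` and restricting to `U`. -/
def IsFacetBetween {V : Type*} (Δ : LowerSet (Finset V)) (C U F : Finset V) : Prop :=
  Maximal (fun F => F ∈ Δ ∧ C ⊆ F ∧ F ⊆ U) F

open Classical in
/-- A shelling order of the family of sets `P`, given by a rank function `ρ`; sets of the same rank
may be put into any order. -/
def IsShellingRank {V : Type*} (P : Finset V → Prop) (ρ : Finset V → ℕ) : Prop :=
  ∀ F G, P F → P G → F ≠ G → ρ G ≤ ρ F →
    ∃ F', P F' ∧ ρ F' < ρ F ∧ ∃ x ∈ F, F ∩ G ⊆ F.erase x ∧ F.erase x ⊆ F'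

open Classical in
/-- `v` is a simplicial vertex of the minor of `Δ` given by contracting `C` and restricting to `U`:
the faces that cannot be extended by `v` are closed under intersection, below any given face. -/
def IsSimplicialBetween {V : Type*} (Δ : LowerSet (Finset V)) (C U : Finset V) (v : V) : Prop :=
  ∀ S T : Finset V, C ⊆ S → S ⊆ U → C ⊆ T → T ⊆ U → v ∉ S → v ∉ T → S ∪ T ∈ Δ →
    insert v S ∉ Δ → insert v T ∉ Δ → insert v (S ∩ T) ∉ Δ

variable {V : Type*}

theorem IsFacetBetween.exists_of_mem [Finite V] {Δ : LowerSet (Finset V)} {C U A : Finset V}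
    (hA : A ∈ Δ) (hC : C ⊆ A) (hU : A ⊆ U) : ∃ F, A ⊆ F ∧ IsFacetBetween Δ C U F :=
  Finite.exists_le_maximal (p := fun F => F ∈ Δ ∧ C ⊆ F ∧ F ⊆ U) ⟨hA, hC, hU⟩

/-- Sorting by rank suffices: the set `F'` has strictly smaller rank, so it precedes `F` however
ties are broken. -/
theorem isShellable_of_isShellingRank [Finite V] {Δ : LowerSet (Finset V)} {ρ : Finset V → ℕ}
    (h : IsShellingRank (IsFacet Δ) ρ) : IsShellable Δ := by
  classical
  have hfin : {S | IsFacet Δ S}.Finite := Set.toFinite _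
  obtain ⟨t, ⟨e⟩⟩ := Finite.exists_equiv_fin {S | IsFacet Δ S}
  let F₀ : Fin t → Finset V := fun i => (e.symm i : Finset V)
  have hF₀ : Function.Injective F₀ := fun i j hij => e.symm.injective (Subtype.ext hij)
  let σ := Tuple.sort (ρ ∘ F₀)
  have hmono : Monotone ((ρ ∘ F₀) ∘ σ) := Tuple.monotone_sort _
  have hinj : Function.Injective (F₀ ∘ σ) := hF₀.comp σ.injective
  have hfac : ∀ i, IsFacet Δ ((F₀ ∘ σ) i) := fun i => (e.symm (σ i)).2
  have hsurj : ∀ S, IsFacet Δ S → ∃ i, (F₀ ∘ σ) i = S := fun S hS =>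
    ⟨σ.symm (e ⟨S, hS⟩), by simp [F₀]⟩
  refine ⟨t, F₀ ∘ σ, hinj, ?_, ?_⟩
  · ext S
    exact ⟨by rintro ⟨i, rfl⟩; exact hfac i, hsurj S⟩
  · intro k _ S hS
    obtain ⟨hSk, hSl⟩ := LowerSet.mem_inf_iff.1 hS.prop
    obtain ⟨_, ⟨i, hi, rfl⟩, hSi⟩ := mem_lowerClosure.1 hSl
    rw [LowerSet.mem_Iic_iff] at hSk
    have hik : i < k := hi
    obtain ⟨F', hF', hlt, x, hx, h1, h2⟩ := h _ _ (hfac k) (hfac i)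
      (fun h => hik.ne (hinj h).symm) (hmono hik.le)
    obtain ⟨j, rfl⟩ := hsurj F' hF'
    have hjk : j < k := by
      by_contra hjk
      exact absurd (hmono (not_lt.1 hjk)) (not_le.2 hlt)
    have hmem : ((F₀ ∘ σ) k).erase x ∈
        LowerSet.Iic ((F₀ ∘ σ) k) ⊓ lowerClosure ((F₀ ∘ σ) '' Set.Iio k) :=
      LowerSet.mem_inf_iff.2 ⟨LowerSet.mem_Iic_iff.2 (Finset.erase_subset _ _),
        mem_lowerClosure.2 ⟨_, ⟨j, hjk, rfl⟩, h2⟩⟩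
    have hle : S ⊆ ((F₀ ∘ σ) k).erase x := (Finset.subset_inter hSk hSi).trans h1
    have hSeq : S = ((F₀ ∘ σ) k).erase x := le_antisymm hle (hS.le_of_ge hmem hle)
    rw [hSeq, Finset.card_erase_add_one hx]

open Classical in
theorem isFacetBetween_insert_iff {Δ : LowerSet (Finset V)} {C U F : Finset V} {v : V}
    (hv : v ∈ F) : IsFacetBetween Δ (insert v C) U F ↔ IsFacetBetween Δ C U F := by
  constructor
  · intro h
    refine ⟨⟨h.prop.1, (Finset.subset_insert _ _).trans h.prop.2.1, h.prop.2.2⟩, ?_⟩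
    intro A hA hFA
    exact h.le_of_ge ⟨hA.1, Finset.insert_subset (hFA hv) hA.2.1, hA.2.2⟩ hFA
  · intro h
    refine ⟨⟨h.prop.1, Finset.insert_subset hv h.prop.2.1, h.prop.2.2⟩, ?_⟩
    intro A hA hFA
    exact h.le_of_ge ⟨hA.1, (Finset.subset_insert _ _).trans hA.2.1, hA.2.2⟩ hFA

-- A face containing `E` cannot contain `v`, so neither deleting `v` from `U` nor enlarging `C` to
-- `E` affects maximality.
open Classical in
theorem isFacetBetween_erase_iff {Δ : LowerSet (Finset V)} {C U F E : Finset V} {v : V}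
    (hvE : insert v E ∉ Δ) (hCE : C ⊆ E) (hEF : E ⊆ F) :
    IsFacetBetween Δ E (U.erase v) F ↔ IsFacetBetween Δ C U F := by
  have hv : ∀ A ∈ Δ, E ⊆ A → v ∉ A := fun A hA hEA hvA =>
    hvE (Δ.lower (Finset.insert_subset hvA hEA) hA)
  constructor
  · intro h
    refine ⟨⟨h.prop.1, hCE.trans hEF, h.prop.2.2.trans (Finset.erase_subset _ _)⟩, ?_⟩
    intro A hA hFA
    exact h.le_of_ge ⟨hA.1, hEF.trans hFA,
      Finset.subset_erase.2 ⟨hA.2.2, hv A hA.1 (hEF.trans hFA)⟩⟩ hFA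
  · intro h
    refine ⟨⟨h.prop.1, hEF, Finset.subset_erase.2 ⟨h.prop.2.2, hv F h.prop.1 hEF⟩⟩, ?_⟩
    intro A hA hFA
    exact h.le_of_ge ⟨hA.1, hCE.trans (hEF.trans hFA),
      hA.2.2.trans (Finset.erase_subset _ _)⟩ hFA

open Classical in
/-- The facets containing a simplicial vertex `v` come first, the others are grouped by the smallest
subset that cannot be extended by `v`. -/
theorem exists_isShellingRank_of_isSimplicialBetween [Finite V] {Δ : LowerSet (Finset V)}
    {C U : Finset V} {v : V} (hvU : v ∈ U) (hs : IsSimplicialBetween Δ C U v)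
    (hlink : ∃ ρ, IsShellingRank (IsFacetBetween Δ (insert v C) U) ρ)
    (hdel : ∀ E, C ⊆ E → E ⊆ U → v ∉ E →
      ∃ ρ, IsShellingRank (IsFacetBetween Δ E (U.erase v)) ρ) :
    ∃ ρ, IsShellingRank (IsFacetBetween Δ C U) ρ := by
  have hmin : ∀ F, ∃ E, IsFacetBetween Δ C U F → v ∉ F →
      C ⊆ E ∧ E ⊆ F ∧ insert v E ∉ Δ ∧ ∀ S, C ⊆ S → S ⊆ F → insert v S ∉ Δ → E ⊆ S := by
    intro F
    by_cases hF : IsFacetBetween Δ C U F ∧ v ∉ F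
    · obtain ⟨hF, hvF⟩ := hF
      have hFv : insert v F ∉ Δ := fun h => hvF <| hF.le_of_ge
        ⟨h, hF.prop.2.1.trans (Finset.subset_insert _ _), Finset.insert_subset hvU hF.prop.2.2⟩
        (Finset.subset_insert _ _) (Finset.mem_insert_self _ _)
      -- A minimal `E` is the smallest: by simpliciality its intersection with any competitor `S` is
      -- again a competitor.
      obtain ⟨E, -, hE⟩ := Finite.exists_le_minimal
        (p := fun S => C ⊆ S ∧ S ⊆ F ∧ insert v S ∉ Δ) ⟨hF.prop.2.1, subset_rfl, hFv⟩
      obtain ⟨hCE, hEF, hEv⟩ := hE.prop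
      refine ⟨E, fun _ _ => ⟨hCE, hEF, hEv, fun S hCS hSF hSv => ?_⟩⟩
      have := hs S E hCS (hSF.trans hF.prop.2.2) hCE (hEF.trans hF.prop.2.2)
        (fun h => hvF (hSF h)) (fun h => hvF (hEF h))
        (Δ.lower (Finset.union_subset hSF hEF) hF.prop.1) hSv hEv
      exact (hE.le_of_le ⟨Finset.subset_inter hCS hCE, Finset.inter_subset_left.trans hSF, this⟩
        Finset.inter_subset_right).trans Finset.inter_subset_left
    · exact ⟨F, fun h1 h2 => (hF ⟨h1, h2⟩).elim⟩
  choose E hE using hmin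
  obtain ⟨ρ₁, hρ₁⟩ := hlink
  have hdel' : ∀ E, ∃ ρ, C ⊆ E → E ⊆ U → v ∉ E →
      IsShellingRank (IsFacetBetween Δ E (U.erase v)) ρ := by
    intro E
    by_cases h : C ⊆ E ∧ E ⊆ U ∧ v ∉ E
    · obtain ⟨ρ, hρ⟩ := hdel E h.1 h.2.1 h.2.2
      exact ⟨ρ, fun _ _ _ => hρ⟩
    · exact ⟨fun _ => 0, fun h1 h2 h3 => (h ⟨h1, h2, h3⟩).elim⟩
  choose ρ₂ hρ₂ using hdel'
  -- The offset `N` places all facets through `v` before the others.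
  obtain ⟨N, hN⟩ : ∃ N, ∀ F, ρ₁ F < N := by
    obtain ⟨M, hM⟩ := (Set.finite_range ρ₁).bddAbove
    exact ⟨M + 1, fun F => Nat.lt_succ_of_le (hM ⟨F, rfl⟩)⟩
  refine ⟨fun F => if v ∈ F then ρ₁ F else N + ρ₂ (E F) F, ?_⟩
  intro F G hF hG hne hle
  by_cases hvF : v ∈ F
  · have hvG : v ∈ G := by
      by_contra hvG
      simp only [hvF, hvG, if_true, if_false] at hle
      have := hN F
      omega
    simp only [hvF, hvG, if_true] at hle ⊢
    obtain ⟨F', hF', hlt, x, hx, h1, h2⟩ := hρ₁ F G ((isFacetBetween_insert_iff hvF).2 hF)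
      ((isFacetBetween_insert_iff hvG).2 hG) hne hle
    have hvF' : v ∈ F' := hF'.prop.2.1 (Finset.mem_insert_self _ _)
    exact ⟨F', (isFacetBetween_insert_iff hvF').1 hF', by simpa [hvF'] using hlt, x, hx, h1, h2⟩
  · obtain ⟨hCE, hEF, hEv, hEmin⟩ := hE F hF hvF
    have hEU : E F ⊆ U := hEF.trans hF.prop.2.2
    have hEeq : ∀ G, IsFacetBetween Δ C U G → E F ⊆ G → v ∉ G ∧ E G = E F := by
      intro G hG hEG
      have hvG : v ∉ G := fun h => hEv (Δ.lower (Finset.insert_subset h hEG) hG.prop.1)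
      obtain ⟨hCE', hEF', hEv', hEmin'⟩ := hE G hG hvG
      have h1 := hEmin' _ hCE hEG hEv
      exact ⟨hvG, h1.antisymm (hEmin _ hCE' (h1.trans hEF) hEv')⟩
    by_cases hEG : E F ⊆ G
    · obtain ⟨hvG, hEG'⟩ := hEeq G hG hEG
      simp only [hvF, hvG, if_false, hEG', add_le_add_iff_left] at hle ⊢
      obtain ⟨F', hF', hlt, x, hx, h1, h2⟩ := hρ₂ (E F) hCE hEU (fun h => hvF (hEF h)) F G
        ((isFacetBetween_erase_iff hEv hCE hEF).2 hF)
        ((isFacetBetween_erase_iff hEv hCE hEG).2 hG) hne hle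
      have hF'' := (isFacetBetween_erase_iff hEv hCE hF'.prop.2.1).1 hF'
      obtain ⟨hvF', hEF'⟩ := hEeq F' hF'' hF'.prop.2.1
      exact ⟨F', hF'', by simpa [hvF', hEF'] using hlt, x, hx, h1, h2⟩
    -- Exchange `y` for `v`: as `E F` is smallest and contains `y`, the set `F - y + v` is a face,
    -- and a facet above it contains `v`, hence comes earlier.
    · obtain ⟨y, hyE, hyG⟩ := Finset.not_subset.1 hEG
      have hyF := hEF hyE
      by_cases hyC : y ∈ C
      · exact absurd (hG.prop.2.1 hyC) hyG
      have hCF : C ⊆ F.erase y := Finset.subset_erase.2 ⟨hF.prop.2.1, hyC⟩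
      have hmem : insert v (F.erase y) ∈ Δ := by
        by_contra h
        exact Finset.notMem_erase y F (hEmin _ hCF (Finset.erase_subset _ _) h hyE)
      obtain ⟨F', hFF', hF'⟩ := IsFacetBetween.exists_of_mem (U := U) hmem
        (hCF.trans (Finset.subset_insert _ _))
        (Finset.insert_subset hvU ((Finset.erase_subset _ _).trans hF.prop.2.2))
      have hvF' : v ∈ F' := hFF' (Finset.mem_insert_self _ _)
      refine ⟨F', hF', ?_, y, hyF, ?_, (Finset.subset_insert _ _).trans hFF'⟩
      · simp only [hvF, hvF', if_true, if_false]
        have := hN F'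
        omega
      · exact Finset.subset_erase.2 ⟨Finset.inter_subset_left,
          fun h => hyG (Finset.mem_inter.1 h).2⟩

/-- A complex all of whose minors have a simplicial vertex is shellable. -/
theorem isShellable_of_forall_exists_isSimplicialBetween [Finite V] {Δ : LowerSet (Finset V)}
    (h : ∀ C U : Finset V, C ⊂ U → ∃ v ∈ U, v ∉ C ∧ IsSimplicialBetween Δ C U v) :
    IsShellable Δ := by
  classical
  have key : ∀ n : ℕ, ∀ C U : Finset V, C ⊆ U → (U \ C).card = n →
      ∃ ρ, IsShellingRank (IsFacetBetween Δ C U) ρ := by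
    intro n
    induction n using Nat.strong_induction_on with
    | _ n ih =>
    intro C U hCU hn
    rcases hCU.eq_or_ssubset with rfl | hss
    -- With `C = U` there is at most one facet.
    · refine ⟨fun _ => 0, fun F G hF hG hne => (hne ?_).elim⟩
      exact (hF.prop.2.2.antisymm hF.prop.2.1).trans (hG.prop.2.2.antisymm hG.prop.2.1).symm
    · obtain ⟨v, hvU, hvC, hv⟩ := h C U hss
      refine exists_isShellingRank_of_isSimplicialBetween hvU hv ?_ ?_
      · refine ih _ ?_ _ _ (Finset.insert_subset hvU hCU) rfl
        rw [← hn]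
        refine Finset.card_lt_card ⟨Finset.sdiff_subset_sdiff subset_rfl
          (Finset.subset_insert _ _), fun hsub => ?_⟩
        simpa using hsub (Finset.mem_sdiff.2 ⟨hvU, hvC⟩)
      · intro E hCE hEU hvE
        refine ih _ ?_ _ _ (Finset.subset_erase.2 ⟨hEU, hvE⟩) rfl
        rw [← hn]
        refine Finset.card_lt_card ⟨Finset.sdiff_subset_sdiff (Finset.erase_subset _ _) hCE,
          fun hsub => ?_⟩
        simpa using hsub (Finset.mem_sdiff.2 ⟨hvU, hvC⟩)
  have := Fintype.ofFinite V
  obtain ⟨ρ, hρ⟩ := key _ ∅ Finset.univ (Finset.empty_subset _) rfl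
  have hiff : IsFacetBetween Δ ∅ Finset.univ = IsFacet Δ := by
    funext F
    simp [IsFacetBetween, IsFacet]
  exact isShellable_of_isShellingRank (hiff ▸ hρ)

end Shelling

/-! ### Connected subsets and simplicial vertices of `Ind r G`. -/

namespace SimpleGraph

variable {V : Type*} {G : SimpleGraph V}

theorem preconnected_induce_iff_exists_walk {s : Set V} :
    (G.induce s).Preconnected ↔
      ∀ a ∈ s, ∀ b ∈ s, ∃ p : G.Walk a b, ∀ x ∈ p.support, x ∈ s := by
  constructor
  · intro h a ha b hb
    obtain ⟨p⟩ := h ⟨a, ha⟩ ⟨b, hb⟩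
    refine ⟨p.map (Embedding.induce s).toHom, fun x hx => ?_⟩
    obtain ⟨y, -, rfl⟩ :=
      List.mem_map.1 ((congrArg (x ∈ ·) (Walk.support_map (Embedding.induce s).toHom p)).mp hx)
    exact y.2
  · rintro h ⟨a, ha⟩ ⟨b, hb⟩
    obtain ⟨p, hp⟩ := h a ha b hb
    exact ⟨p.induce s hp⟩

theorem preconnected_induce_union {s t : Set V} {v : V} (hs : (G.induce s).Preconnected)
    (ht : (G.induce t).Preconnected) (hvs : v ∈ s) (hvt : v ∈ t) :
    (G.induce (s ∪ t)).Preconnected :=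
  (induce_union_connected hs ht ⟨v, hvs, hvt⟩).preconnected

/-- A set is `r`-independent if and only if its connected subsets have at most `r` elements. -/
theorem isRIndep_iff_forall_card_le {r : ℕ} {A : Finset V} :
    G.IsRIndep r A ↔
      ∀ X ⊆ A, (G.induce (X : Set V)).Preconnected → X.card ≤ r := by
  classical
  constructor
  · intro h X hXA hX
    rcases X.eq_empty_or_nonempty with rfl | ⟨v, hv⟩
    · simp
    have hvA : v ∈ (A : Set V) := hXA hv
    refine le_trans ?_ (h ((G.induce (A : Set V)).connectedComponentMk ⟨v, hvA⟩))
    rw [← Set.ncard_image_of_injective _ Subtype.val_injective, ← Set.ncard_coe_finset X]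
    refine Set.ncard_le_ncard ?_ ((Set.toFinite _).image _)
    intro x hx
    refine ⟨⟨x, hXA hx⟩, ?_, rfl⟩
    obtain ⟨p, hp⟩ := preconnected_induce_iff_exists_walk.1 hX x hx v hv
    exact ConnectedComponent.sound ⟨p.induce _ fun y hy => hXA (hp y hy)⟩
  · intro h K
    have hfin : (Subtype.val '' K.supp : Set V).Finite := (Set.toFinite _).image _
    rw [← Set.ncard_image_of_injective _ Subtype.val_injective, Set.ncard_eq_toFinset_card _ hfin]
    refine h _ ?_ ?_
    · intro x hx
      obtain ⟨y, -, rfl⟩ := hfin.mem_toFinset.1 hx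
      exact y.2
    · rw [hfin.coe_toFinset, preconnected_induce_iff_exists_walk]
      rintro _ ⟨a, ha, rfl⟩ _ ⟨b, hb, rfl⟩
      obtain ⟨p⟩ := ConnectedComponent.exact (ha.trans hb.symm)
      refine ⟨p.map (Embedding.induce (A : Set V)).toHom, fun x hx => ?_⟩
      obtain ⟨y, hy, rfl⟩ := List.mem_map.1
        ((congrArg (x ∈ ·) (Walk.support_map (Embedding.induce (A : Set V)).toHom p)).mp hx)
      refine ⟨y, ?_, rfl⟩
      exact (ConnectedComponent.sound ⟨(p.takeUntil y hy).reverse⟩).trans ha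

-- A large connected set avoiding `v` would lie in the `r`-independent set `B`.
open Classical in
theorem exists_large_preconnected_of_not_isRIndep_insert {r : ℕ} {A B : Finset V} {v : V}
    (hB : G.IsRIndep r B) (hAB : A ⊆ B) (h : ¬ G.IsRIndep r (insert v A)) :
    ∃ X ⊆ insert v A, v ∈ X ∧ (G.induce (X : Set V)).Preconnected ∧ r < X.card := by
  rw [isRIndep_iff_forall_card_le] at h
  push Not at h
  obtain ⟨X, hXA, hX, hr⟩ := h
  refine ⟨X, hXA, ?_, hX, hr⟩
  by_contra hv
  exact hr.not_ge <| isRIndep_iff_forall_card_le.1 hB X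
    (((Finset.subset_insert_iff_of_notMem hv).1 hXA).trans hAB) hX

/-- Connected sets remain connected upon the removal of a vertex whose neighbors form a clique. -/
theorem preconnected_induce_sdiff_singleton {v : V} (hv : G.IsClique (G.neighborSet v)) {s : Set V}
    (hs : (G.induce s).Preconnected) : (G.induce (s \ {v})).Preconnected := by
  -- When the walk has arrived at `a = v`, the vertex `c` remembers where it came from; it equals or
  -- is adjacent to the vertex following `v`, so `v` can be skipped.
  have key : ∀ {a b : V} (p : G.Walk a b), (∀ x ∈ p.support, x ∈ s) → b ≠ v →
      ∀ c ∈ s, c ≠ v → (c = a ∨ (a = v ∧ G.Adj v c)) →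
        ∃ q : G.Walk c b, ∀ x ∈ q.support, x ∈ s \ {v} := by
    intro a b p
    induction p with
    | nil =>
      rintro hp hb c hc hcv (rfl | ⟨rfl, -⟩)
      · exact ⟨.nil, by simp [hc, hcv]⟩
      · exact (hb rfl).elim
    | @cons a a' b ha p ih =>
      intro hp hb c hc hcv hca
      have hp' : ∀ x ∈ p.support, x ∈ s := fun x hx => hp x (by simp [hx])
      have ha's : a' ∈ s := hp' a' p.start_mem_support
      by_cases ha'v : a' = v
      · rcases hca with rfl | ⟨rfl, -⟩
        · exact ih hp' hb c hc hcv (Or.inr ⟨ha'v, ha'v ▸ ha.symm⟩)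
        · exact (ha.ne ha'v.symm).elim
      · obtain ⟨q, hq⟩ := ih hp' hb a' ha's ha'v (Or.inl rfl)
        have hor : c = a' ∨ G.Adj c a' := by
          rcases hca with rfl | ⟨rfl, hac⟩
          · exact Or.inr ha
          · by_cases h : c = a'
            · exact Or.inl h
            · exact Or.inr (hv hac ha h)
        rcases hor with rfl | hadj
        · exact ⟨q, hq⟩
        · refine ⟨.cons hadj q, fun x hx => ?_⟩
          rw [Walk.support_cons, List.mem_cons] at hx
          rcases hx with rfl | hx
          · exact ⟨hc, hcv⟩
          · exact hq x hx
  rw [preconnected_induce_iff_exists_walk] at hs ⊢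
  rintro a ⟨ha, hav⟩ b ⟨hb, hbv⟩
  obtain ⟨p, hp⟩ := hs a ha b hb
  exact key p hp hbv a ha hav (Or.inl rfl)

/-- Large connected sets `X` in `S + v` and `Y` in `T + v` must coincide: `X ∪ Y` minus `v` is
connected inside a face, so `X ∪ Y` has at most `r + 1` elements, while `X` and `Y` have at least
that many. -/
theorem isSimplicialBetween_Ind_of_isClique_neighborSet {r : ℕ} {v : V}
    (hv : G.IsClique (G.neighborSet v)) (C U : Finset V) :
    IsSimplicialBetween (Ind r G) C U v := by
  classical
  intro S T _ _ _ _ hvS hvT hST hS hT hI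
  obtain ⟨X, hXS, hvX, hX, hrX⟩ :=
    exists_large_preconnected_of_not_isRIndep_insert hST Finset.subset_union_left hS
  obtain ⟨Y, hYT, hvY, hY, hrY⟩ :=
    exists_large_preconnected_of_not_isRIndep_insert hST Finset.subset_union_right hT
  have hXY := preconnected_induce_sdiff_singleton hv
    (preconnected_induce_union (v := v) hX hY hvX hvY)
  have hcard : ((X ∪ Y).erase v).card ≤ r := by
    refine isRIndep_iff_forall_card_le.1 hST _ ?_
      (by rwa [Finset.coe_erase, Finset.coe_union])
    rw [← Finset.subset_insert_iff, Finset.insert_union_distrib]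
    exact Finset.union_subset_union hXS hYT
  rw [Finset.card_erase_of_mem (Finset.mem_union_left _ hvX)] at hcard
  have hXeq : X = X ∪ Y := Finset.eq_of_subset_of_card_le Finset.subset_union_left (by omega)
  have hYeq : Y = X ∪ Y := Finset.eq_of_subset_of_card_le Finset.subset_union_right (by omega)
  refine hrX.not_ge (isRIndep_iff_forall_card_le.1 hI X ?_ hX)
  rw [Finset.insert_inter_distrib]
  exact Finset.subset_inter hXS ((hXeq.trans hYeq.symm).trans_subset hYT)

/-- The set `W` can be seen from `v` in linear order: of two other vertices of `W`, one separates
the other one from `v`. -/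
def IsLinearFrom (G : SimpleGraph V) (W : Set V) (v : V) : Prop :=
  ∀ j ∈ W, ∀ k ∈ W, j ≠ v → k ≠ v → j ≠ k →
    (∀ p : G.Walk v k, j ∈ p.support) ∨ (∀ p : G.Walk v j, k ∈ p.support)

/-- Otherwise a connected set `X` in `S + v` reaches some `j` outside `T`, and `Y` in `T + v`
reaches some `k` outside `S`. Both lie in `U \ C`, so linearity forces `j` into `Y` or `k` into `X`.
-/
theorem isSimplicialBetween_Ind_of_isLinearFrom {r : ℕ} {v : V} {C U : Finset V}
    (h : G.IsLinearFrom {x | x ∈ U ∧ x ∉ C} v) : IsSimplicialBetween (Ind r G) C U v := by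
  classical
  intro S T hCS hSU hCT hTU hvS hvT hST hS hT hI
  obtain ⟨X, hXS, hvX, hX, hrX⟩ :=
    exists_large_preconnected_of_not_isRIndep_insert hST Finset.subset_union_left hS
  obtain ⟨Y, hYT, hvY, hY, hrY⟩ :=
    exists_large_preconnected_of_not_isRIndep_insert hST Finset.subset_union_right hT
  rw [preconnected_induce_iff_exists_walk] at hX hY
  have hXI : ¬ X ⊆ insert v T := fun hXT => hrX.not_ge <| isRIndep_iff_forall_card_le.1 hI X
    (by rw [Finset.insert_inter_distrib]; exact Finset.subset_inter hXS hXT)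
    (preconnected_induce_iff_exists_walk.2 hX)
  have hYI : ¬ Y ⊆ insert v S := fun hYS => hrY.not_ge <| isRIndep_iff_forall_card_le.1 hI Y
    (by rw [Finset.insert_inter_distrib]; exact Finset.subset_inter hYS hYT)
    (preconnected_induce_iff_exists_walk.2 hY)
  obtain ⟨j, hjX, hjT⟩ := Finset.not_subset.1 hXI
  obtain ⟨k, hkY, hkS⟩ := Finset.not_subset.1 hYI
  obtain ⟨p, hp⟩ := hX v hvX j hjX
  obtain ⟨q, hq⟩ := hY v hvY k hkY
  have hjS := hXS hjX
  have hkT := hYT hkY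
  have hjS' : j ∈ S := by simp only [Finset.mem_insert, not_or] at hjS hjT; tauto
  have hkT' : k ∈ T := by simp only [Finset.mem_insert, not_or] at hkT hkS; tauto
  simp only [Finset.mem_insert, not_or] at hjT hkS
  rcases h j ⟨hSU hjS', fun hj => hjT.2 (hCT hj)⟩ k ⟨hTU hkT', fun hk => hkS.2 (hCS hk)⟩
    hjT.1 hkS.1 (fun hjk => hkS.2 (hjk ▸ hjS')) with h | h
  · have := hYT (hq j (h q))
    simp only [Finset.mem_insert] at this
    tauto
  · have := hXS (hp k (h p))
    simp only [Finset.mem_insert] at this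
    tauto

/-- Shellability of `Ind r G` when the vertices that are not simplicial are linearly arranged. -/
theorem isShellable_Ind_of_exists_isLinearFrom [Finite V]
    (h : ∀ W : Set V, W.Nonempty → (∀ w ∈ W, ¬ G.IsClique (G.neighborSet w)) →
      ∃ v ∈ W, G.IsLinearFrom W v) (r : ℕ) : IsShellable (Ind r G) := by
  refine isShellable_of_forall_exists_isSimplicialBetween fun C U hCU => ?_
  by_cases hex : ∃ v ∈ U, v ∉ C ∧ G.IsClique (G.neighborSet v)
  · obtain ⟨v, hvU, hvC, hv⟩ := hex
    exact ⟨v, hvU, hvC, isSimplicialBetween_Ind_of_isClique_neighborSet hv C U⟩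
  · push Not at hex
    obtain ⟨u, huU, huC⟩ := Finset.exists_of_ssubset hCU
    obtain ⟨v, ⟨hvU, hvC⟩, hv⟩ := h {x | x ∈ U ∧ x ∉ C} ⟨u, huU, huC⟩ fun w hw => hex w hw.1 hw.2
    exact ⟨v, hvU, hvC, isSimplicialBetween_Ind_of_isLinearFrom hv⟩

/-! ### Cycles and maximal cliques in block graphs. -/

theorem preconnected_induce_of_forall_walk {s : Set V} (b : V)
    (h : ∀ x ∈ s, ∃ p : G.Walk x b, ∀ y ∈ p.support, y ∈ s) : (G.induce s).Preconnected := by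
  rw [preconnected_induce_iff_exists_walk]
  intro x hx y hy
  obtain ⟨p, hp⟩ := h x hx
  obtain ⟨q, hq⟩ := h y hy
  refine ⟨p.append q.reverse, fun z hz => ?_⟩
  rw [Walk.mem_support_append_iff, Walk.support_reverse, List.mem_reverse] at hz
  exact hz.elim (hp z) (hq z)

/-- The vertex set of a cycle, given as a path together with a vertex adjacent to both of its ends,
is nonseparable. -/
theorem isNonseparable_insert_support {a u w : V} (hau : G.Adj a u) (haw : G.Adj a w)
    {q : G.Walk u w} (hq : q.IsPath) (ha : a ∉ q.support) :
    G.IsNonseparable (insert a {x | x ∈ q.support}) := by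
  classical
  have hQ := q.connected_induce_support
  constructor
  · have : insert a {x | x ∈ q.support} = {a, u} ∪ {x | x ∈ q.support} := by
      ext x
      simp only [Set.mem_insert_iff, Set.mem_ofPred_eq, Set.mem_union, Set.mem_singleton_iff]
      have := q.start_mem_support
      grind
    rw [this]
    exact induce_union_connected (induce_pair_connected_of_adj hau).preconnected hQ.preconnected
      ⟨u, by simp, q.start_mem_support⟩
  · intro z hz
    by_cases hza : z = a
    · have : insert a {x | x ∈ q.support} \ {z} = {x | x ∈ q.support} := by
        subst hza
        exact Set.insert_sdiff_self_of_notMem ha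
      rw [this]
      exact hQ.preconnected
    · refine preconnected_induce_of_forall_walk a ?_
      rintro y ⟨rfl | hy, hyz⟩
      · exact ⟨.nil, by simpa using hyz⟩
      -- The deleted vertex `z` blocks at most one of the two ways from `y` around the cycle to `a`.
      · have hdisj : z ∉ (q.takeUntil y hy).support ∨ z ∉ (q.dropUntil y hy).support := by
          by_contra! hcon
          have hnd := hq.support_nodup
          rw [← q.take_spec hy, Walk.support_append] at hnd
          have hz2 := hcon.2
          rw [← Walk.cons_tail_support, List.mem_cons] at hz2
          rcases hz2 with rfl | hz2
          · exact hyz rfl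
          · exact (List.nodup_append.1 hnd).2.2 z hcon.1 z hz2 rfl
        rcases hdisj with h | h
        · refine ⟨(q.takeUntil y hy).reverse.append (.cons hau.symm .nil), fun x hx => ?_⟩
          simp only [Walk.mem_support_append_iff, Walk.support_reverse, List.mem_reverse,
            Walk.support_cons, Walk.support_nil, List.mem_cons, List.not_mem_nil, or_false] at hx
          rcases hx with hx | rfl | rfl
          · exact ⟨Or.inr (q.support_takeUntil_subset_support hy hx), fun hxz => h (hxz ▸ hx)⟩
          · exact ⟨Or.inr q.start_mem_support,
              fun hxz => h (hxz ▸ (q.takeUntil y hy).start_mem_support)⟩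
          · exact ⟨Or.inl rfl, fun hxz => hza hxz.symm⟩
        · refine ⟨(q.dropUntil y hy).append (.cons haw.symm .nil), fun x hx => ?_⟩
          simp only [Walk.mem_support_append_iff,
            Walk.support_cons, Walk.support_nil, List.mem_cons, List.not_mem_nil, or_false] at hx
          rcases hx with hx | rfl | rfl
          · exact ⟨Or.inr (q.support_dropUntil_subset_support hy hx), fun hxz => h (hxz ▸ hx)⟩
          · exact ⟨Or.inr q.end_mem_support,
              fun hxz => h (hxz ▸ (q.dropUntil y hy).end_mem_support)⟩
          · exact ⟨Or.inl rfl, fun hxz => hza hxz.symm⟩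

namespace IsBlockGraph

variable [Finite V]

theorem isClique_of_isNonseparable (hG : G.IsBlockGraph) {s : Set V} (hs : G.IsNonseparable s) :
    G.IsClique s := by
  obtain ⟨t, hst, ht⟩ := Finite.exists_le_maximal (p := G.IsNonseparable) hs
  exact (hG t ht).subset hst

/-- In a block graph, two neighbors of `a` that are joined by a walk avoiding `a` are adjacent. -/
theorem adj_of_walk (hG : G.IsBlockGraph) {a u w : V} (hau : G.Adj a u) (haw : G.Adj a w)
    (huw : u ≠ w) (p : G.Walk u w) (ha : a ∉ p.support) : G.Adj u w := by
  classical
  have hq := isNonseparable_insert_support hau haw p.bypass_isPath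
    (fun h => ha (p.support_bypass_subset_support h))
  exact hG.isClique_of_isNonseparable hq (Or.inr p.bypass.start_mem_support)
    (Or.inr p.bypass.end_mem_support) huw

/-- The union is a clique: for `p` in `K` and `q` in `L`, distinct from each other and from `x` and
`y`, the walk `p, y, q` avoids their common neighbor `x`. -/
theorem eq_of_maximal_isClique (hG : G.IsBlockGraph) {K L : Set V} (hK : Maximal G.IsClique K)
    (hL : Maximal G.IsClique L) {x y : V} (hxy : x ≠ y) (hxK : x ∈ K) (hyK : y ∈ K) (hxL : x ∈ L)
    (hyL : y ∈ L) : K = L := by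
  have key : ∀ p ∈ K, ∀ q ∈ L, p ≠ q → G.Adj p q := by
    intro p hp q hq hpq
    by_cases hpx : p = x
    · exact hL.prop (hpx ▸ hxL) hq hpq
    by_cases hqx : q = x
    · exact hK.prop hp (hqx ▸ hxK) hpq
    by_cases hpy : p = y
    · exact hL.prop (hpy ▸ hyL) hq hpq
    by_cases hqy : q = y
    · exact hK.prop hp (hqy ▸ hyK) hpq
    refine hG.adj_of_walk (hK.prop hxK hp (Ne.symm hpx)) (hL.prop hxL hq (Ne.symm hqx)) hpq
      (.cons (hK.prop hp hyK hpy) (.cons (hL.prop hyL hq (Ne.symm hqy)) .nil)) ?_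
    simp only [Walk.support_cons, Walk.support_nil, List.mem_cons, List.not_mem_nil, or_false]
    grind
  have hun : G.IsClique (K ∪ L) := by
    rintro p (hp | hp) q (hq | hq) hpq
    · exact hK.prop hp hq hpq
    · exact key p hp q hq hpq
    · exact (key q hq p hp hpq.symm).symm
    · exact hL.prop hp hq hpq
  exact (hK.eq_of_subset hun Set.subset_union_left).trans
    (hL.eq_of_subset hun Set.subset_union_right).symm

end IsBlockGraph

/-! ### Clique paths indexed by natural numbers. -/

/-- A sequence `C 0, …, C (n - 1)` of maximal cliques forming a clique path, with connecting
vertices `x 0, …, x (n - 2)`. -/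
structure IsSpine (G : SimpleGraph V) (n : ℕ) (C : ℕ → Set V) (x : ℕ → V) : Prop where
  maximal : ∀ i < n, Maximal G.IsClique (C i)
  ne : ∀ i j, i < j → j < n → C i ≠ C j
  inter : ∀ i, i + 1 < n → C i ∩ C (i + 1) = {x i}
  disjoint : ∀ i j, i + 1 < j → j < n → Disjoint (C i) (C j)

theorem IsCliquePath.exists_isSpine [Nonempty V] {n : ℕ} {B : Fin n → Set V}
    (hB : G.IsCliquePath B) : ∃ C x, G.IsSpine n C x ∧ ∀ i : Fin n, C i = B i := by
  -- The values of `C` and `x` out of range are irrelevant, since every condition bounds its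
  -- indices.
  let C : ℕ → Set V := fun i => if h : i < n then B ⟨i, h⟩ else ∅
  have hC : ∀ i (h : i < n), C i = B ⟨i, h⟩ := fun i h => dif_pos h
  have hx : ∀ i, ∃ x, i + 1 < n → C i ∩ C (i + 1) = {x} := by
    intro i
    by_cases h : i + 1 < n
    · obtain ⟨x, hx⟩ := hB.consecutive ⟨i, by omega⟩ ⟨i + 1, h⟩ rfl
      exact ⟨x, fun _ => by rw [hC i (by omega), hC _ h, hx]⟩
    · exact ⟨Classical.arbitrary V, fun h' => (h h').elim⟩
  choose x hx using hx
  refine ⟨C, x, ⟨fun i h => ?_, fun i j hij hj => ?_, hx, fun i j hij hj => ?_⟩,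
    fun i => hC i i.2⟩
  · rw [hC i h]
    exact hB.maximal _
  · rw [hC i (hij.trans hj), hC j hj]
    exact fun h => hij.ne (Fin.mk.inj_iff.1 (hB.injective h))
  · rw [hC i (by omega), hC j hj]
    exact hB.nonconsecutive _ _ hij

namespace IsSpine

variable {n : ℕ} {C : ℕ → Set V} {x : ℕ → V}

theorem mem_left (h : G.IsSpine n C x) {i : ℕ} (hi : i + 1 < n) : x i ∈ C i :=
  ((h.inter i hi).ge rfl).1

theorem mem_right (h : G.IsSpine n C x) {i : ℕ} (hi : i + 1 < n) : x i ∈ C (i + 1) :=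
  ((h.inter i hi).ge rfl).2

theorem connecting_ne (h : G.IsSpine n C x) {i j : ℕ} (hij : i < j) (hj : j + 1 < n) :
    x i ≠ x j := fun he =>
  Set.disjoint_left.1 (h.disjoint i (j + 1) (by omega) hj) (h.mem_left (by omega))
    (he ▸ h.mem_right hj)

theorem adj_succ (h : G.IsSpine n C x) {i : ℕ} (hi : i + 2 < n) : G.Adj (x i) (x (i + 1)) :=
  (h.maximal (i + 1) (by omega)).prop (h.mem_right (by omega)) (h.mem_left hi)
    (h.connecting_ne (Nat.lt_succ_self i) hi)

theorem exists_walk (h : G.IsSpine n C x) {i j : ℕ} (hij : i ≤ j) (hj : j + 1 < n) :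
    ∃ p : G.Walk (x i) (x j), ∀ y ∈ p.support, ∃ k, i ≤ k ∧ k ≤ j ∧ y = x k := by
  induction j, hij using Nat.le_induction with
  | base => exact ⟨.nil, fun y hy => ⟨i, le_rfl, le_rfl, by simpa using hy⟩⟩
  | succ j hij ih =>
    obtain ⟨p, hp⟩ := ih (by omega)
    refine ⟨p.concat (h.adj_succ hj), fun y hy => ?_⟩
    rw [Walk.support_concat, List.mem_append, List.mem_singleton] at hy
    rcases hy with hy | rfl
    · obtain ⟨k, h1, h2, rfl⟩ := hp y hy
      exact ⟨k, h1, by omega, rfl⟩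
    · exact ⟨j + 1, by omega, le_rfl, rfl⟩

variable [Finite V]

/-- A connecting vertex separates the connecting vertices before it from those after it. -/
theorem mem_support_of_walk (h : G.IsSpine n C x) (hG : G.IsBlockGraph) {i j k : ℕ} (hij : i < j)
    (hjk : j < k) (hk : k + 1 < n) (p : G.Walk (x i) (x k)) : x j ∈ p.support := by
  by_contra hp
  obtain ⟨j, rfl⟩ : ∃ j', j = j' + 1 := ⟨j - 1, by omega⟩
  obtain ⟨q₁, hq₁⟩ := h.exists_walk (i := i) (j := j) (by omega) (by omega)
  obtain ⟨q₂, hq₂⟩ := h.exists_walk (i := j + 2) (j := k) (by omega) hk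
  have h1 : G.Adj (x j) (x (j + 1)) := h.adj_succ (by omega)
  have h2 : G.Adj (x (j + 1)) (x (j + 2)) := h.adj_succ (by omega)
  -- Extended along the path at both ends, a walk avoiding `x (j + 1)` joins its two neighbors. The
  -- resulting triangle shares an edge with `C (j + 1)` and one with `C (j + 2)`, which would make
  -- these cliques equal.
  have h3 : G.Adj (x j) (x (j + 2)) := by
    refine hG.adj_of_walk h1.symm h2 (h.connecting_ne (by omega) (by omega))
      ((q₁.reverse.append p).append q₂.reverse) ?_
    simp only [Walk.mem_support_append_iff, Walk.support_reverse, List.mem_reverse, not_or]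
    refine ⟨⟨fun hm => ?_, hp⟩, fun hm => ?_⟩
    · obtain ⟨l, -, hl, he⟩ := hq₁ _ hm
      exact h.connecting_ne (i := l) (j := j + 1) (by omega) (by omega) he.symm
    · obtain ⟨l, hl, hl', he⟩ := hq₂ _ hm
      exact h.connecting_ne (i := j + 1) (j := l) (by omega) (by omega) he
  have hcl : G.IsClique {x j, x (j + 1), x (j + 2)} := by
    simp [isClique_iff, h1, h2, h3]
  obtain ⟨K, hsub, hK⟩ := Finite.exists_le_maximal (p := G.IsClique) hcl
  have e1 := hG.eq_of_maximal_isClique hK (h.maximal (j + 1) (by omega)) h1.ne (hsub (by simp))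
    (hsub (by simp)) (h.mem_right (by omega)) (h.mem_left (by omega))
  have e2 := hG.eq_of_maximal_isClique hK (h.maximal (j + 2) (by omega)) h2.ne (hsub (by simp))
    (hsub (by simp)) (h.mem_right (by omega)) (h.mem_left (by omega))
  exact h.ne (j + 1) (j + 2) (by omega) (by omega) (e1.symm.trans e2)

/-- If all other maximal cliques are attached to connecting vertices, then only connecting vertices
lie in two different maximal cliques. -/
theorem exists_eq_connecting (h : G.IsSpine n C x) (hG : G.IsBlockGraph)
    (hatt : ∀ K, Maximal G.IsClique K → (∀ i < n, K ≠ C i) →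
      ∃ i, i + 1 < n ∧ K ∩ (⋃ i < n, C i) = {x i})
    {v : V} (hv : ¬ G.IsClique (G.neighborSet v)) : ∃ i, i + 1 < n ∧ v = x i := by
  have hU : ∀ {i y}, i < n → y ∈ C i → y ∈ ⋃ i < n, C i := fun hi hy =>
    Set.mem_biUnion hi hy
  have hmix : ∀ {K i}, Maximal G.IsClique K → (∀ i < n, K ≠ C i) → i < n → v ∈ K → v ∈ C i →
      ∃ i, i + 1 < n ∧ v = x i := by
    intro K i hK hne hi hvK hvi
    obtain ⟨j, hj, he⟩ := hatt K hK hne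
    exact ⟨j, hj, he.le ⟨hvK, hU hi hvi⟩⟩
  have hspine : ∀ {i j}, i < j → j < n → v ∈ C i → v ∈ C j → ∃ i, i + 1 < n ∧ v = x i := by
    intro i j hij hj hvi hvj
    by_cases hj' : j = i + 1
    · subst hj'
      exact ⟨i, hj, (h.inter i hj).le ⟨hvi, hvj⟩⟩
    · exact (Set.disjoint_left.1 (h.disjoint i j (by omega) hj) hvi hvj).elim
  -- Two nonadjacent neighbors of `v` give edges at `v` in different maximal cliques.
  obtain ⟨K, L, hK, hL, hvK, hvL, hKL⟩ : ∃ K L, Maximal G.IsClique K ∧ Maximal G.IsClique L ∧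
      v ∈ K ∧ v ∈ L ∧ K ≠ L := by
    simp only [isClique_iff, Set.Pairwise, mem_neighborSet] at hv
    push Not at hv
    obtain ⟨a, ha, b, hb, hab, hnab⟩ := hv
    obtain ⟨K, haK, hK⟩ := Finite.exists_le_maximal (p := G.IsClique)
      (isClique_pair.2 fun _ => ha)
    obtain ⟨L, hbL, hL⟩ := Finite.exists_le_maximal (p := G.IsClique)
      (isClique_pair.2 fun _ => hb)
    refine ⟨K, L, hK, hL, haK (by simp), hbL (by simp), ?_⟩
    rintro rfl
    exact hnab (hK.prop (haK (by simp)) (hbL (by simp)) hab)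
  by_cases hK' : ∃ i < n, K = C i
  · obtain ⟨i, hi, rfl⟩ := hK'
    by_cases hL' : ∃ j < n, L = C j
    · obtain ⟨j, hj, rfl⟩ := hL'
      rcases lt_trichotomy i j with hij | rfl | hij
      · exact hspine hij hj hvK hvL
      · exact (hKL rfl).elim
      · exact hspine hij hi hvL hvK
    · push Not at hL'
      exact hmix hL hL' hi hvL hvK
  · push Not at hK'
    by_cases hL' : ∃ j < n, L = C j
    · obtain ⟨j, hj, rfl⟩ := hL'
      exact hmix hK hK' hj hvK hvL
    · push Not at hL'
      by_contra hvx
      push Not at hvx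
      -- Two cliques off the path cannot meet in a vertex `v` that is not connecting. Attached at
      -- the same `x i`, they share two vertices; attached at `x i` and `x j`, they close a cycle
      -- with the path, which puts `x j` into `K`.
      have key : ∀ {i j K L}, Maximal G.IsClique K → Maximal G.IsClique L → v ∈ K → v ∈ L →
          K ≠ L → i + 1 < n → j + 1 < n → K ∩ (⋃ i < n, C i) = {x i} →
          L ∩ (⋃ i < n, C i) = {x j} → i ≤ j → False := by
        intro i j K L hK hL hvK hvL hKL hi hj hxi hxj hij
        have hxK : x i ∈ K := (hxi.ge rfl).1
        have hxL : x j ∈ L := (hxj.ge rfl).1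
        rcases hij.eq_or_lt with rfl | hij
        · exact hKL (hG.eq_of_maximal_isClique hK hL (hvx i hi) hvK hxK hvL hxL)
        · obtain ⟨p, hp⟩ := h.exists_walk hij.le hj
          have hvi := hK.prop hvK hxK (hvx i hi)
          have hvj := hL.prop hvL hxL (hvx j hj)
          have hadj : G.Adj (x i) (x j) := by
            refine hG.adj_of_walk hvi hvj (h.connecting_ne hij hj) p fun hm => ?_
            obtain ⟨k, -, hk, he⟩ := hp v hm
            exact hvx k (by omega) he
          have hcl : G.IsClique {v, x i, x j} := by
            simp [isClique_iff, hvi, hvj, hadj]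
          obtain ⟨M, hsub, hM⟩ := Finite.exists_le_maximal (p := G.IsClique) hcl
          have hKM := hG.eq_of_maximal_isClique hM hK hvi.ne (hsub (by simp)) (hsub (by simp))
            hvK hxK
          have hjK : x j ∈ K := hKM ▸ hsub (by simp)
          exact h.connecting_ne hij hj
            (hxi.le ⟨hjK, hU (i := j) (by omega) (h.mem_left hj)⟩ : x j = x i).symm
      obtain ⟨i, hi, hxi⟩ := hatt K hK hK'
      obtain ⟨j, hj, hxj⟩ := hatt L hL hL'
      rcases le_total i j with hij | hij
      · exact key hK hL hvK hvL hKL hi hj hxi hxj hij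
      · exact key hL hK hvL hvK hKL.symm hj hi hxj hxi hij

end IsSpine

/-! ### Linear arrangement of the nonsimplicial vertices of a `𝒯₁`-graph. -/

theorem IsConnectedT1Graph.exists_isLinearFrom [Finite V] (hG : G.IsConnectedT1Graph) {W : Set V}
    (hW : W.Nonempty) (hns : ∀ w ∈ W, ¬ G.IsClique (G.neighborSet w)) :
    ∃ v ∈ W, G.IsLinearFrom W v := by
  classical
  obtain ⟨hconn, hblock, n, B, hB, -, hatt⟩ := hG
  have := hconn.nonempty
  obtain ⟨C, x, hx, hCB⟩ := hB.exists_isSpine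
  have hunion : (⋃ i < n, C i) = ⋃ i, B i := by
    ext y
    simp only [Set.mem_iUnion, exists_prop]
    exact ⟨fun ⟨i, hi, hy⟩ => ⟨⟨i, hi⟩, hCB ⟨i, hi⟩ ▸ hy⟩, fun ⟨i, hy⟩ => ⟨i, i.2, hCB i ▸ hy⟩⟩
  have hcv : ∀ w ∈ W, ∃ i, i + 1 < n ∧ w = x i := fun w hw => by
    refine hx.exists_eq_connecting hblock (fun K hK hKC => ?_) (hns w hw)
    obtain ⟨y, ⟨i, j, hij, hy⟩, hKy⟩ := hatt K hK
      (by rintro ⟨i, rfl⟩; exact hKC i i.2 (hCB i).symm)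
    have hi : (i : ℕ) + 1 < n := hij ▸ j.2
    refine ⟨i, hi, ?_⟩
    rw [hunion, hKy, ← hy, ← hx.inter i hi, hCB i, ← hij, hCB j]
  -- The vertex sought is the connecting vertex in `W` of least index: all others in `W` lie beyond
  -- it, and the nearer of two separates the farther.
  have hex : ∃ i, i + 1 < n ∧ x i ∈ W := by
    obtain ⟨w, hw⟩ := hW
    obtain ⟨i, hi, rfl⟩ := hcv w hw
    exact ⟨i, hi, hw⟩
  obtain ⟨hi, hiW⟩ := Nat.find_spec hex
  have hmin : ∀ k, k + 1 < n → x k ∈ W → Nat.find hex ≤ k := fun k h1 h2 =>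
    Nat.find_min' hex ⟨h1, h2⟩
  generalize Nat.find hex = i at hi hiW hmin
  refine ⟨x i, hiW, fun j hj k hk hji hki hjk => ?_⟩
  obtain ⟨a, ha, rfl⟩ := hcv j hj
  obtain ⟨b, hb, rfl⟩ := hcv k hk
  have hia : i < a := lt_of_le_of_ne (hmin a ha hj) fun h => hji (h ▸ rfl)
  have hib : i < b := lt_of_le_of_ne (hmin b hb hk) fun h => hki (h ▸ rfl)
  rcases lt_trichotomy a b with hab | rfl | hab
  · exact Or.inl (hx.mem_support_of_walk hblock hia hab hb)
  · exact (hjk rfl).elim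
  · exact Or.inr (hx.mem_support_of_walk hblock hib hab ha)

/-- It suffices to treat one component meeting `W`: vertices outside it are not reachable from `v`,
so their separation from `v` is vacuous. -/
theorem IsT1Graph.exists_isLinearFrom [Finite V] (hG : G.IsT1Graph) {W : Set V}
    (hW : W.Nonempty) (hns : ∀ w ∈ W, ¬ G.IsClique (G.neighborSet w)) :
    ∃ v ∈ W, G.IsLinearFrom W v := by
  classical
  obtain ⟨w₀, hw₀⟩ := hW
  let C := G.connectedComponentMk w₀
  have hmem : ∀ {a b : V}, a ∈ C.supp → G.Walk a b → b ∈ C.supp := fun ha p =>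
    (ConnectedComponent.sound ⟨p.reverse⟩).trans ha
  obtain ⟨v, hvW, hv⟩ := (hG C).exists_isLinearFrom (W := {c | (c : V) ∈ W}) ⟨⟨w₀, rfl⟩, hw₀⟩ <| by
    intro c hc hcl
    refine hns c hc fun a ha b hb hab => ?_
    have haC : a ∈ C.supp := hmem c.2 (.cons ha .nil)
    have hbC : b ∈ C.supp := hmem c.2 (.cons hb .nil)
    exact hcl (x := ⟨a, haC⟩) ha (y := ⟨b, hbC⟩) hb fun h => hab (congrArg Subtype.val h)
  have hlift : ∀ {j k : C}, (∀ p : C.toSimpleGraph.Walk v k, j ∈ p.support) →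
      ∀ p : G.Walk v k, (j : V) ∈ p.support := by
    intro j k h p
    have hp : ∀ y ∈ p.support, y ∈ C.supp := fun y hy => hmem v.2 (p.takeUntil y hy)
    have hj := h (p.induce C.supp hp)
    have hj' := (congrArg (j ∈ ·) (Walk.support_induce (s := C.supp) p hp)).mp hj
    simpa using hj'
  refine ⟨v, hvW, fun j hj k hk hjv hkv hjk => ?_⟩
  by_cases hjC : j ∈ C.supp
  · by_cases hkC : k ∈ C.supp
    · exact (hv ⟨j, hjC⟩ hj ⟨k, hkC⟩ hk (fun h => hjv (congrArg Subtype.val h))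
        (fun h => hkv (congrArg Subtype.val h)) (fun h => hjk (congrArg Subtype.val h))).imp
        hlift hlift
    · exact Or.inl fun p => (hkC (hmem v.2 p)).elim
  · exact Or.inr fun p => (hjC (hmem v.2 p)).elim

end SimpleGraph

theorem theorem4p15 {V : Type*} [Finite V] (G : SimpleGraph V) (hG : G.IsT1Graph)
    (r : ℕ) (hr : 5 ≤ r) : IsShellable (SimpleGraph.Ind r G) :=
  SimpleGraph.isShellable_Ind_of_exists_isLinearFrom
    (fun _ hW hns => hG.exists_isLinearFrom hW hns) r
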